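/- Let $\mathrm{HTop}_*$ be the category of pointed topological spaces and pointed homotopy classes of pointed maps, and let $\mathrm{HPol}_*$ be its full subcategory of spaces having the pointed homotopy type of a pointed polyhedron $(|K|,x_0)$ ($K$ a simplicial complex, $|K|$ with the weak topology). An $\mathrm{HPol}_*$-expansion of $(X,x)$ is a family of morphisms $p_\lambda:(X,x)\to(X_\lambda,x_\lambda)$ of $\mathrm{HTop}_*$ into the terms of an inverse system $((X_\lambda,x_\lambda),p_{\lambda\lambda'},\Lambda)$ in $\mathrm{HPol}_*$ over a directed set $\Lambda$, with $p_{\lambda\lambda'}p_{\lambda'}=p_\lambda$ for $\lambda\le\lambda'$, such that every morphism $h:(X,x)\to Q$ with $Q$ in $\mathrm{HPol}_*$ is of the form $h=f p_\lambda$ for some $\lambda$ and $f$, and such that $f_0p_\lambda=f_1p_\lambda$ with values in an object of $\mathrm{HPol}_*$ implies $f_0p_{\lambda\lambda'}=f_1p_{\lambda\lambda'}$ for some $\lambda'\ge\lambda$. For inverse systems $\mathbf X,\mathbf Y$, a morphism $\mathbf X\to\mathbf Y$ of pro$^*$ is represented by an index function $f:M\to\Lambda$ and morphisms $f^n_\mu:X_{f(\mu)}\to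 Y_\mu$ ($n\in\mathbb N$, $\mu\in M$) such that for all $\mu\le\mu'$ there are $\lambda\ge f(\mu),f(\mu')$ and $n$ with $q_{\mu\mu'}f^{n'}_{\mu'}p_{f(\mu')\lambda}=f^{n'}_\mu p_{f(\mu)\lambda}$ for all $n'\ge n$; two representatives $(f,f^n_\mu)$, $(g,g^n_\mu)$ are identified if for each $\mu$ there are $\lambda\ge f(\mu),g(\mu)$ and $n$ with $f^{n'}_\mu p_{f(\mu)\lambda}=g^{n'}_\mu p_{g(\mu)\lambda}$ for all $n'\ge n$. A coarse shape morphism in $Sh^*((Y,y),(X,x))$ is a pro$^*$-morphism between $\mathrm{HPol}_*$-expansions of $(Y,y)$ and $(X,x)$, where morphisms between different expansions are identified if they correspond to each other under the canonical isomorphisms of the expansions. Each morphism of $\mathrm{HTop}_*$, in particular $p_\lambda$, induces a coarse shape morphism, denoted by the same letter. The set $Sh^*((Y,y),(X,x))$ carries the topology with basis the sets $V_\lambda^{F}=\{G : p_\lambda\circ G=p_\lambda\circ F\}$, for any $\mathrm{HPol}_*$-expansion of $(X,x)$ (it does not depend on the expansion). For $k\ge 1$ let $\check\pi_k^{*^{top}}(X,x)=Sh^*((S^k,*),(X,x))$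 with this topology and with the group operation obtained by representing elements by families $(f^n_\lambda)$ of pointed homotopy classes of maps $(S^k,*)\to(X_\lambda,x_\lambda)$ and adding these in $\pi_k(X_\lambda,x_\lambda)$ for each $n$ and $\lambda$. **Theorem.** Let $(X,x)$ be a pointed topological space and let $k\ge 1$. (i) If $(X,x)\in\mathrm{HPol}_*$, then $\check\pi_k^{*^{top}}(X,x)$ is discrete. (ii) If $\mathbf p:(X,x)\to((X_\lambda,x_\lambda),p_{\lambda\lambda'},\Lambda)$ is an $\mathrm{HPol}_*$-expansion of $(X,x)$ and $\check\pi_k^{*^{top}}(X,x)$ is discrete, then for some $\lambda\in\Lambda$ the homomorphism $(p_\lambda)_*:\check\pi_k^{*^{top}}(X,x)\to\check\pi_k^{*^{top}}(X_\lambda,x_\lambda)$, $F\mapsto p_\lambda\circ F$, is injective and a topological embedding; that is, it embeds $\check\pi_k^{*^{top}}(X,x)$ as a subgroup of $\check\pi_k^{*^{top}}(X_\lambda,x_\lambda)$. -/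

import Mathlib

universe w v u

namespace CoarseShape

open CategoryTheory Topology

/-! ### Inverse systems and the category pro* -/

section ProStar

/-- An inverse system `(X_λ, p_{λλ'}, Λ)` in a category `C`, indexed by a directed preordered set. -/
structure InvSys (C : Type u) [Category.{v} C] where
  Idx : Type w
  [preorder : Preorder Idx]
  [directed : IsDirectedOrder Idx]
  [nonempty : Nonempty Idx]
  obj : Idx → C
  bond : ∀ {l l' : Idx}, l ≤ l' → (obj l' ⟶ obj l)
  bond_refl : ∀ l : Idx, bond (le_refl l) = 𝟙 (obj l)
  bond_comp : ∀ {l l' l'' : Idx} (h : l ≤ l') (h' : l' ≤ l''),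
    bond h' ≫ bond h = bond (h.trans h')

attribute [instance] InvSys.preorder InvSys.directed InvSys.nonempty

variable {C : Type u} [Category.{v} C]

/-- An `S*`-morphism `(f, f^n_μ) : 𝐗 → 𝐘` of inverse systems. -/
structure SStar (X Y : InvSys.{w} C) where
  idx : Y.Idx → X.Idx
  hom : ∀ (_ : ℕ) (m : Y.Idx), X.obj (idx m) ⟶ Y.obj m
  compat : ∀ {m m' : Y.Idx} (h : m ≤ m'), ∃ (l : X.Idx) (h₁ : idx m ≤ l) (h₂ : idx m' ≤ l) (n : ℕ),
    ∀ n' ≥ n, X.bond h₂ ≫ hom n' m' ≫ Y.bond h = X.bond h₁ ≫ hom n' m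

namespace SStar

/-- Equivalence of `S*`-morphisms. -/
def Equiv {X Y : InvSys.{w} C} (f g : SStar X Y) : Prop :=
  ∀ m : Y.Idx, ∃ (l : X.Idx) (h₁ : f.idx m ≤ l) (h₂ : g.idx m ≤ l) (n : ℕ),
    ∀ n' ≥ n, X.bond h₁ ≫ f.hom n' m = X.bond h₂ ≫ g.hom n' m

/-- An equality that holds after restriction to `l` also holds after restriction to `l' ≥ l`. -/
theorem restrict {X : InvSys.{w} C} {Z : C} {a b l l' : X.Idx} {f : X.obj a ⟶ Z} {g : X.obj b ⟶ Z}
    {h₁ : a ≤ l} {h₂ : b ≤ l} (e : X.bond h₁ ≫ f = X.bond h₂ ≫ g) (h : l ≤ l') :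
    X.bond (h₁.trans h) ≫ f = X.bond (h₂.trans h) ≫ g := by
  rw [← X.bond_comp h₁ h, ← X.bond_comp h₂ h, Category.assoc, Category.assoc, e]

theorem equiv_equivalence (X Y : InvSys.{w} C) : Equivalence (Equiv (X := X) (Y := Y)) where
  refl f m := ⟨f.idx m, le_rfl, le_rfl, 0, fun _ _ => rfl⟩
  symm h m := by
    obtain ⟨l, h₁, h₂, n, H⟩ := h m
    exact ⟨l, h₂, h₁, n, fun n' hn => (H n' hn).symm⟩
  trans {f g k} hfg hgk m := by
    obtain ⟨l, h₁, h₂, n, H⟩ := hfg m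
    obtain ⟨l', h₁', h₂', n', H'⟩ := hgk m
    obtain ⟨L, hl, hl'⟩ := exists_ge_ge l l'
    refine ⟨L, h₁.trans hl, h₂'.trans hl', max n n', fun N hN => ?_⟩
    rw [restrict (H N (le_of_max_le_left hN)) hl, ← restrict (H' N (le_of_max_le_right hN)) hl']

instance setoid (X Y : InvSys.{w} C) : Setoid (SStar X Y) := ⟨Equiv, equiv_equivalence X Y⟩

/-- The identity `S*`-morphism. -/
def id (X : InvSys.{w} C) : SStar X X where
  idx l := l
  hom _ l := 𝟙 (X.obj l)
  compat {m m'} h := ⟨m', h, le_rfl, 0, fun _ _ => by simp [X.bond_refl]⟩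

/-- The composition of `S*`-morphisms: `h = f g` on indices and `h^n_ν = g^n_ν f^n_{g(ν)}`. -/
def comp {X Y Z : InvSys.{w} C} (f : SStar X Y) (g : SStar Y Z) : SStar X Z where
  idx k := f.idx (g.idx k)
  hom n k := f.hom n (g.idx k) ≫ g.hom n k
  compat {k k'} h := by
    obtain ⟨m, h₁, h₂, n, H⟩ := g.compat h
    obtain ⟨l₁, a₁, b₁, n₁, H₁⟩ := f.compat h₁
    obtain ⟨l₂, a₂, b₂, n₂, H₂⟩ := f.compat h₂
    obtain ⟨L, c₁, c₂⟩ := exists_ge_ge l₁ l₂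
    refine ⟨L, a₁.trans c₁, a₂.trans c₂, max n (max n₁ n₂), fun N hN => ?_⟩
    have hn : n ≤ N := le_of_max_le_left hN
    have hn₁ : n₁ ≤ N := (le_max_left _ _).trans (le_of_max_le_right hN)
    have hn₂ : n₂ ≤ N := (le_max_right _ _).trans (le_of_max_le_right hN)
    have e₁ := restrict (H₁ N hn₁) c₁
    have e₂ := restrict (H₂ N hn₂) c₂
    have e := H N hn
    calc _ = (X.bond (a₂.trans c₂) ≫ f.hom N (g.idx k')) ≫ g.hom N k' ≫ Z.bond h := by simp
      _ = (X.bond (b₂.trans c₂) ≫ f.hom N m) ≫ Y.bond h₂ ≫ g.hom N k' ≫ Z.bond h := by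
        rw [← e₂]; simp
      _ = (X.bond (b₂.trans c₂) ≫ f.hom N m) ≫ Y.bond h₁ ≫ g.hom N k := by rw [e]
      _ = (X.bond (b₁.trans c₁) ≫ f.hom N m ≫ Y.bond h₁) ≫ g.hom N k := by simp
      _ = _ := by rw [e₁]; simp

theorem comp_congr {X Y Z : InvSys.{w} C} {f f' : SStar X Y} {g g' : SStar Y Z}
    (hf : Equiv f f') (hg : Equiv g g') : Equiv (f.comp g) (f'.comp g') := by
  refine (equiv_equivalence X Z).trans (y := f.comp g') (fun k => ?_) (fun k => ?_)
  · obtain ⟨m, h₁, h₂, n, H⟩ := hg k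
    obtain ⟨l₁, a₁, b₁, n₁, H₁⟩ := f.compat h₁
    obtain ⟨l₂, a₂, b₂, n₂, H₂⟩ := f.compat h₂
    obtain ⟨L, c₁, c₂⟩ := exists_ge_ge l₁ l₂
    refine ⟨L, a₁.trans c₁, a₂.trans c₂, max n (max n₁ n₂), fun N hN => ?_⟩
    have hn : n ≤ N := le_of_max_le_left hN
    have hn₁ : n₁ ≤ N := (le_max_left _ _).trans (le_of_max_le_right hN)
    have hn₂ : n₂ ≤ N := (le_max_right _ _).trans (le_of_max_le_right hN)
    have e₁ := restrict (H₁ N hn₁) c₁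
    have e₂ := restrict (H₂ N hn₂) c₂
    have e := H N hn
    calc _ = (X.bond (a₁.trans c₁) ≫ f.hom N (g.idx k)) ≫ g.hom N k := by simp [comp]
      _ = (X.bond (b₁.trans c₁) ≫ f.hom N m) ≫ Y.bond h₁ ≫ g.hom N k := by rw [← e₁]; simp
      _ = (X.bond (b₂.trans c₂) ≫ f.hom N m ≫ Y.bond h₂) ≫ g'.hom N k := by rw [e]; simp
      _ = _ := by rw [e₂]; simp [comp]
  · obtain ⟨l, h₁, h₂, n, H⟩ := hf (g'.idx k)
    exact ⟨l, h₁, h₂, n, fun N hN => by simp [comp, reassoc_of% (H N hN)]⟩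

end SStar

/-- The category `pro*-C`: objects are the inverse systems in `C`, morphisms are the equivalence
classes of `S*`-morphisms. -/
instance proStar : Category (InvSys.{w} C) where
  Hom X Y := Quotient (SStar.setoid X Y)
  id X := ⟦SStar.id X⟧
  comp f g := Quotient.map₂ SStar.comp (fun _ _ hf _ _ hg => SStar.comp_congr hf hg) f g
  id_comp f := by
    induction f using Quotient.inductionOn with | _ f => ?_
    exact congrArg (Quotient.mk _) (by simp [SStar.comp, SStar.id])
  comp_id f := by
    induction f using Quotient.inductionOn with | _ f => ?_
    exact congrArg (Quotient.mk _) (by simp [SStar.comp, SStar.id])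
  assoc f g h := by
    induction f using Quotient.inductionOn with | _ f => ?_
    induction g using Quotient.inductionOn with | _ g => ?_
    induction h using Quotient.inductionOn with | _ h => ?_
    exact congrArg (Quotient.mk _) (by simp [SStar.comp])

/-- A morphism `(f, f_μ) : 𝐗 → 𝐘` of inverse systems; these represent the morphisms of `pro-C`. -/
structure ProRep (X Y : InvSys.{w} C) where
  idx : Y.Idx → X.Idx
  hom : ∀ m : Y.Idx, X.obj (idx m) ⟶ Y.obj m
  compat : ∀ {m m' : Y.Idx} (h : m ≤ m'), ∃ (l : X.Idx) (h₁ : idx m ≤ l) (h₂ : idx m' ≤ l),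
    X.bond h₂ ≫ hom m' ≫ Y.bond h = X.bond h₁ ≫ hom m

/-- The functor `J : pro-C → pro*-C` on representatives: `f^n_μ = f_μ` for all `n`. -/
def ProRep.toProStar {X Y : InvSys.{w} C} (f : ProRep X Y) : X ⟶ Y :=
  Quotient.mk (SStar.setoid X Y)
    { idx := f.idx
      hom := fun _ m => f.hom m
      compat := fun h => by
        obtain ⟨l, h₁, h₂, e⟩ := f.compat h
        exact ⟨l, h₁, h₂, 0, fun _ _ => e⟩ }

/-- The rudimentary inverse system `(X)`, indexed by one point. -/
def rudimentary (X : C) : InvSys.{w} C where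
  Idx := PUnit
  obj _ := X
  bond _ := 𝟙 X
  bond_refl _ := rfl
  bond_comp _ _ := Category.comp_id _

end ProStar

/-! ### Expansions and the coarse shape category -/

section Shape

variable {C : Type u} [Category.{v} C] (P : ObjectProperty C)

/-- A `P`-expansion `𝐩 : X → 𝐗` of the object `X`, where `P` is (the class of objects of) a full
subcategory. A morphism of `pro-C` from the rudimentary system `(X)` to `𝐗` is a family of
morphisms `p_λ : X → X_λ` which is compatible with the bonding morphisms. -/
structure Expansion (X : C) where
  sys : InvSys.{w} C
  mem : ∀ l, P (sys.obj l)
  proj : ∀ l, X ⟶ sys.obj l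
  proj_bond : ∀ {l l' : sys.Idx} (h : l ≤ l'), proj l' ≫ sys.bond h = proj l
  /-- Every morphism from `X` to an object of `P` factors through some `p_λ`. -/
  exists_factor : ∀ {Q : C}, P Q → ∀ h : X ⟶ Q, ∃ (l : sys.Idx) (f : sys.obj l ⟶ Q),
    proj l ≫ f = h
  /-- The factorization is unique after passing to a later index. -/
  factor_unique : ∀ {Q : C}, P Q → ∀ {l : sys.Idx} (f₀ f₁ : sys.obj l ⟶ Q),
    proj l ≫ f₀ = proj l ≫ f₁ → ∃ (l' : sys.Idx) (h : l ≤ l'), sys.bond h ≫ f₀ = sys.bond h ≫ f₁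

variable {P}

/-- The rudimentary expansion of an object of `P`. -/
def Expansion.rud {X : C} (hX : P X) : Expansion.{w} P X where
  sys := rudimentary X
  mem _ := hX
  proj _ := 𝟙 X
  proj_bond _ := Category.comp_id _
  exists_factor _ h := ⟨PUnit.unit, h, Category.id_comp _⟩
  factor_unique _ _ f₀ f₁ e := ⟨PUnit.unit, le_rfl, by
    simpa [rudimentary] using e⟩

namespace Expansion

/-- `𝐟 : 𝐗 → 𝐘` is (the image in `pro*-C` of) a morphism of `pro-C` with `𝐟 𝐩 = 𝐪 f`. -/
def IsLift {X Y : C} (p : Expansion.{w} P X) (q : Expansion.{w} P Y) (f : X ⟶ Y)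
    (F : p.sys ⟶ q.sys) : Prop :=
  ∃ r : ProRep p.sys q.sys, (∀ m, p.proj (r.idx m) ≫ r.hom m = f ≫ q.proj m) ∧ F = r.toProStar

variable {X Y Z : C} (p : Expansion.{w} P X) (q : Expansion.{w} P Y) (r : Expansion.{w} P Z)

/-- Two morphisms from terms of an expansion to an object of `P` with equal composites from `X`
agree on a later term. -/
theorem exists_eq {Q : C} (hQ : P Q) {a b : p.sys.Idx} (f : p.sys.obj a ⟶ Q)
    (g : p.sys.obj b ⟶ Q) (e : p.proj a ≫ f = p.proj b ≫ g) :
    ∃ (l : p.sys.Idx) (h₁ : a ≤ l) (h₂ : b ≤ l), p.sys.bond h₁ ≫ f = p.sys.bond h₂ ≫ g := by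
  obtain ⟨c, ha, hb⟩ := exists_ge_ge a b
  obtain ⟨l, h, H⟩ := p.factor_unique hQ (p.sys.bond ha ≫ f) (p.sys.bond hb ≫ g) (by
    rw [← Category.assoc, ← Category.assoc, p.proj_bond, p.proj_bond, e])
  refine ⟨l, ha.trans h, hb.trans h, ?_⟩
  rwa [← Category.assoc, ← Category.assoc, p.sys.bond_comp, p.sys.bond_comp] at H

theorem existsUnique_isLift (f : X ⟶ Y) : ∃! F : p.sys ⟶ q.sys, IsLift p q f F := by
  choose i g hg using fun m => p.exists_factor (q.mem m) (f ≫ q.proj m)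
  refine ⟨_, ⟨⟨i, g, fun {m m'} h => ?_⟩, hg, rfl⟩, ?_⟩
  · obtain ⟨l, h₁, h₂, e⟩ := p.exists_eq (q.mem m) (g m' ≫ q.sys.bond h) (g m) (by
      rw [← Category.assoc, hg, hg, Category.assoc, q.proj_bond])
    exact ⟨l, h₂, h₁, e⟩
  · rintro _ ⟨s, hs, rfl⟩
    refine Quotient.sound fun m => ?_
    obtain ⟨l, h₁, h₂, e⟩ := p.exists_eq (q.mem m) (s.hom m) (g m) ((hs m).trans (hg m).symm)
    exact ⟨l, h₁, h₂, 0, fun _ _ => e⟩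

/-- The unique morphism `𝐟 : 𝐗 → 𝐘` of `pro-C` (regarded in `pro*-C`) with `𝐟 𝐩 = 𝐪 f`. -/
noncomputable def lift (f : X ⟶ Y) : p.sys ⟶ q.sys := (existsUnique_isLift p q f).choose

theorem isLift_lift (f : X ⟶ Y) : IsLift p q f (lift p q f) :=
  (existsUnique_isLift p q f).choose_spec.1

variable {p q r} in
theorem IsLift.eq_lift {f : X ⟶ Y} {F : p.sys ⟶ q.sys} (h : IsLift p q f F) : F = lift p q f :=
  (existsUnique_isLift p q f).choose_spec.2 F h

@[simp]
theorem lift_id : lift p p (𝟙 X) = 𝟙 p.sys := by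
  refine (IsLift.eq_lift ⟨⟨fun l => l, fun l => 𝟙 _, fun {m m'} h => ⟨m', h, le_rfl, ?_⟩⟩,
    fun m => by simp, rfl⟩).symm
  simp [p.sys.bond_refl]

@[simp]
theorem lift_comp (f : X ⟶ Y) (g : Y ⟶ Z) : lift p q f ≫ lift q r g = lift p r (f ≫ g) := by
  obtain ⟨s, hs, es⟩ := isLift_lift p q f
  obtain ⟨t, ht, et⟩ := isLift_lift q r g
  have key : ∀ k, p.proj (s.idx (t.idx k)) ≫ s.hom (t.idx k) ≫ t.hom k = (f ≫ g) ≫ r.proj k :=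
    fun k => by rw [← Category.assoc, hs, Category.assoc, ht, Category.assoc]
  refine IsLift.eq_lift ⟨⟨fun k => s.idx (t.idx k), fun k => s.hom (t.idx k) ≫ t.hom k,
    fun {k k'} h => ?_⟩, key, ?_⟩
  · obtain ⟨l, h₁, h₂, e⟩ := p.exists_eq (r.mem k)
      ((s.hom (t.idx k') ≫ t.hom k') ≫ r.sys.bond h) (s.hom (t.idx k) ≫ t.hom k) (by
        rw [← Category.assoc, key, key, Category.assoc, r.proj_bond])
    exact ⟨l, h₂, h₁, e⟩
  · rw [es, et]; rfl

@[simp]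
theorem lift_comp_assoc (f : X ⟶ Y) (g : Y ⟶ Z) {W : InvSys.{w} C} (h : r.sys ⟶ W) :
    lift p q f ≫ lift q r g ≫ h = lift p r (f ≫ g) ≫ h := by
  rw [← Category.assoc, lift_comp]

end Expansion

variable (P)

/-- A morphism of `pro*-P` between (systems of) expansions of `Y` and of `X`. -/
structure ShRep (Y X : C) where
  source : Expansion.{w} P Y
  target : Expansion.{w} P X
  hom : source.sys ⟶ target.sys

/-- `pro*-P` equivalence: `J(𝐣) 𝐟* = 𝐟'* J(𝐢)`, where `𝐢` and `𝐣` are the canonical isomorphisms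
between the expansions (the unique morphisms of `pro-P` with `𝐢 𝐪 = 𝐪'` and `𝐣 𝐩 = 𝐩'`). -/
def ShRep.setoid (Y X : C) : Setoid (ShRep.{w} P Y X) where
  r f g := f.hom ≫ f.target.lift g.target (𝟙 X) = f.source.lift g.source (𝟙 Y) ≫ g.hom
  iseqv :=
    { refl := fun f => by simp
      symm := fun {f g} h => by
        have := congrArg
          (fun t => g.source.lift f.source (𝟙 Y) ≫ t ≫ g.target.lift f.target (𝟙 X)) h
        simpa using this.symm
      trans := fun {f g k} h h' => by
        have e : f.target.lift g.target (𝟙 X) ≫ g.target.lift k.target (𝟙 X) =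
          f.target.lift k.target (𝟙 X) := by simp
        rw [← e, reassoc_of% h, h', Expansion.lift_comp_assoc, Category.comp_id] }

/-- The set `Sh*(Y, X)` of coarse shape morphisms for the pair `(C, P)`. -/
def Sh (Y X : C) := Quotient (ShRep.setoid.{w} P Y X)

variable {P}

namespace Sh

variable {X Y Z : C}

/-- The coarse shape morphism `<𝐟*>`. -/
def mk (q : Expansion.{w} P Y) (p : Expansion.{w} P X) (f : q.sys ⟶ p.sys) : Sh.{w} P Y X :=
  Quotient.mk (ShRep.setoid P Y X) ⟨q, p, f⟩

theorem mk_eq_mk {q q' : Expansion.{w} P Y} {p p' : Expansion.{w} P X} {f : q.sys ⟶ p.sys}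
    {f' : q'.sys ⟶ p'.sys} :
    mk q p f = mk q' p' f' ↔ f ≫ p.lift p' (𝟙 X) = q.lift q' (𝟙 Y) ≫ f' :=
  Quotient.eq (r := ShRep.setoid P Y X)

/-- Composition of coarse shape morphisms, `<𝐠*> <𝐟*> = <𝐠* 𝐟*>`. The two representatives are
composed through the canonical isomorphism of the two expansions of `Y`. -/
noncomputable def comp (F : Sh.{w} P X Y) (G : Sh.{w} P Y Z) : Sh.{w} P X Z :=
  Quotient.map₂ (sa := ShRep.setoid P X Y) (sb := ShRep.setoid P Y Z) (sc := ShRep.setoid P X Z)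
    (fun f g => ⟨f.source, g.target, f.hom ≫ f.target.lift g.source (𝟙 Y) ≫ g.hom⟩)
    (fun f f' hf g g' hg => by
      change (f.hom ≫ f.target.lift g.source (𝟙 Y) ≫ g.hom) ≫ g.target.lift g'.target (𝟙 Z) =
        f.source.lift f'.source (𝟙 X) ≫ f'.hom ≫ f'.target.lift g'.source (𝟙 Y) ≫ g'.hom
      change f.hom ≫ f.target.lift f'.target (𝟙 Y) = f.source.lift f'.source (𝟙 X) ≫ f'.hom at hf
      change g.hom ≫ g.target.lift g'.target (𝟙 Z) = g.source.lift g'.source (𝟙 Y) ≫ g'.hom at hg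
      rw [← reassoc_of% hf, Category.assoc, Category.assoc, hg]
      simp) F G

/-- The coarse shape functor `S*` on a morphism `f : X → Y`, computed with given expansions. -/
noncomputable def ofHom (p : Expansion.{w} P X) (q : Expansion.{w} P Y) (f : X ⟶ Y) :
    Sh.{w} P X Y := mk p q (p.lift q f)

/-- `S*(f)` does not depend on the expansions. -/
theorem ofHom_eq (p p' : Expansion.{w} P X) (q q' : Expansion.{w} P Y) (f : X ⟶ Y) :
    ofHom p q f = ofHom p' q' f := by
  simp [ofHom, mk_eq_mk]

/-- The bijection of `Sh*(Y, X)` with the morphisms of `pro*-P` between two given expansions. -/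
noncomputable def repr (q : Expansion.{w} P Y) (p : Expansion.{w} P X) :
    Sh.{w} P Y X ≃ (q.sys ⟶ p.sys) where
  toFun F := Quotient.lift (s := ShRep.setoid P Y X)
    (fun f => q.lift f.source (𝟙 Y) ≫ f.hom ≫ f.target.lift p (𝟙 X))
    (fun f g h => by
      change f.hom ≫ f.target.lift g.target (𝟙 X) = f.source.lift g.source (𝟙 Y) ≫ g.hom at h
      have e : f.target.lift p (𝟙 X) =
        f.target.lift g.target (𝟙 X) ≫ g.target.lift p (𝟙 X) := by simp
      rw [e, reassoc_of% h]
      simp) F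
  invFun f := mk q p f
  left_inv F := by
    induction F using Quotient.inductionOn with | _ f => ?_
    change mk _ _ _ = mk _ _ _
    rw [mk_eq_mk]
    simp
  right_inv f := by
    change q.lift q (𝟙 Y) ≫ f ≫ p.lift p (𝟙 X) = f
    simp

theorem repr_mk (q q' : Expansion.{w} P Y) (p p' : Expansion.{w} P X) (f : q'.sys ⟶ p'.sys) :
    repr q p (mk q' p' f) = q.lift q' (𝟙 Y) ≫ f ≫ p'.lift p (𝟙 X) := rfl

theorem exists_mk (q : Expansion.{w} P Y) (p : Expansion.{w} P X) (F : Sh.{w} P Y X) :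
    ∃ f, F = mk q p f := ⟨repr q p F, ((repr q p).symm_apply_apply F).symm⟩

theorem mk_comp_mk (q : Expansion.{w} P X) (p : Expansion.{w} P Y) (r : Expansion.{w} P Z)
    (f : q.sys ⟶ p.sys) (g : p.sys ⟶ r.sys) : (mk q p f).comp (mk p r g) = mk q r (f ≫ g) := by
  change mk q r (f ≫ p.lift p (𝟙 Y) ≫ g) = _
  simp

theorem repr_lift (q : Expansion.{w} P Y) (p p' : Expansion.{w} P X) (F : Sh.{w} P Y X) :
    repr q p' F = repr q p F ≫ p.lift p' (𝟙 X) := by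
  obtain ⟨f, rfl⟩ := exists_mk q p F
  rw [repr_mk, repr_mk]
  simp

theorem repr_comp (q : Expansion.{w} P X) (p : Expansion.{w} P Y) (r : Expansion.{w} P Z)
    (F : Sh.{w} P X Y) (g : p.sys ⟶ r.sys) : repr q r (F.comp (mk p r g)) = repr q p F ≫ g := by
  obtain ⟨f, rfl⟩ := exists_mk q p F
  rw [mk_comp_mk, repr_mk, repr_mk]
  simp

theorem comp_assoc {W : C} (F : Sh.{w} P W X) (G : Sh.{w} P X Y) (H : Sh.{w} P Y Z) :
    (F.comp G).comp H = F.comp (G.comp H) := by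
  induction F using Quotient.inductionOn with | _ f => ?_
  induction G using Quotient.inductionOn with | _ g => ?_
  induction H using Quotient.inductionOn with | _ h => ?_
  change mk _ _ _ = mk _ _ _
  simp

theorem comp_ofHom_id (F : Sh.{w} P Y X) (p : Expansion.{w} P X) :
    F.comp (ofHom p p (𝟙 X)) = F := by
  induction F using Quotient.inductionOn with | _ f => ?_
  change mk _ _ _ = mk _ _ _
  simp [mk_eq_mk]

theorem ofHom_comp (p : Expansion.{w} P X) (q : Expansion.{w} P Y) (r : Expansion.{w} P Z)
    (f : X ⟶ Y) (g : Y ⟶ Z) : (ofHom p q f).comp (ofHom q r g) = ofHom p r (f ≫ g) := by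
  simp [ofHom, mk_comp_mk]

end Sh

/-- The coarse shape morphism `p_λ = S*(p_λ) : X → X_λ`. -/
noncomputable def Expansion.shProj {X : C} (p : Expansion.{w} P X) (l : p.sys.Idx) :
    Sh.{w} P X (p.sys.obj l) :=
  Sh.ofHom p (Expansion.rud (p.mem l)) (p.proj l)

/-- `V_λ^F = {G ∈ Sh*(Y, X) | p_λ ∘ F = p_λ ∘ G}`. -/
def Sh.basicSet {X Y : C} (p : Expansion.{w} P X) (l : p.sys.Idx) (F : Sh.{w} P Y X) :
    Set (Sh.{w} P Y X) :=
  {G | F.comp (p.shProj l) = G.comp (p.shProj l)}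

/-- The topology of `Sh*(Y, X)`, generated by the sets `V_λ^F` for the `P`-expansions of `X`. -/
instance Sh.topology {X Y : C} : TopologicalSpace (Sh.{w} P Y X) :=
  TopologicalSpace.generateFrom
    {V | ∃ (p : Expansion.{w} P X) (l : p.sys.Idx) (F : Sh.{w} P Y X), V = Sh.basicSet p l F}

/-- For each single expansion of `X` the sets `V_λ^F` already form a basis of this topology. -/
theorem Sh.isTopologicalBasis {X : C} (Y : C) (p : Expansion.{w} P X) :
    TopologicalSpace.IsTopologicalBasis
      {V | ∃ (l : p.sys.Idx) (F : Sh.{w} P Y X), V = Sh.basicSet p l F} := by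
  have fac : ∀ (p' : Expansion.{w} P X) (l' : p'.sys.Idx), ∃ l : p.sys.Idx,
      ∀ F G : Sh.{w} P Y X, F.comp (p.shProj l) = G.comp (p.shProj l) →
        F.comp (p'.shProj l') = G.comp (p'.shProj l') := by
    intro p' l'
    obtain ⟨l, f, hf⟩ := p.exists_factor (p'.mem l') (p'.proj l')
    refine ⟨l, fun F G h => ?_⟩
    have e : p'.shProj l' =
        (p.shProj l).comp (Sh.ofHom (.rud (p.mem l)) (.rud (p'.mem l')) f) := by
      rw [Expansion.shProj, Expansion.shProj, Sh.ofHom_comp, hf]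
      exact Sh.ofHom_eq _ _ _ _ _
    rw [e, ← Sh.comp_assoc, ← Sh.comp_assoc, h]
  have mono : ∀ {l l' : p.sys.Idx} (_ : l ≤ l') (F G : Sh.{w} P Y X),
      F.comp (p.shProj l') = G.comp (p.shProj l') →
        F.comp (p.shProj l) = G.comp (p.shProj l) := by
    intro l l' h F G hFG
    have e : p.shProj l =
        (p.shProj l').comp (Sh.ofHom (.rud (p.mem l')) (.rud (p.mem l)) (p.sys.bond h)) := by
      rw [Expansion.shProj, Expansion.shProj, Sh.ofHom_comp, p.proj_bond]
    rw [e, ← Sh.comp_assoc, ← Sh.comp_assoc, hFG]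
  refine TopologicalSpace.isTopologicalBasis_of_isOpen_of_nhds ?_ ?_
  · rintro _ ⟨l, F, rfl⟩
    exact TopologicalSpace.isOpen_generateFrom_of_mem ⟨p, l, F, rfl⟩
  · intro F U hF hU
    suffices H : ∃ l, Sh.basicSet p l F ⊆ U from
      H.elim fun l hl => ⟨_, ⟨l, F, rfl⟩, rfl, hl⟩
    induction hU with
    | basic V hV =>
      obtain ⟨p', l', F', rfl⟩ := hV
      obtain ⟨l, hl⟩ := fac p' l'
      exact ⟨l, fun G hG => Eq.trans hF (hl F G hG)⟩
    | univ => exact ⟨Classical.arbitrary _, fun _ _ => trivial⟩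
    | inter U V _ _ hU' hV' =>
      obtain ⟨a, ha⟩ := hU' hF.1
      obtain ⟨b, hb⟩ := hV' hF.2
      obtain ⟨c, hac, hbc⟩ := exists_ge_ge a b
      exact ⟨c, fun G hG => ⟨ha (mono hac F G hG), hb (mono hbc F G hG)⟩⟩
    | sUnion S _ ih =>
      obtain ⟨V, hV, hFV⟩ := hF
      obtain ⟨l, hl⟩ := ih V hV hFV
      exact ⟨l, fun G hG => ⟨V, hV, hl hG⟩⟩

end Shape

/-! ### The pointed homotopy category and pointed polyhedra -/

section Pointed

open scoped unitInterval

/-- Pointed topological spaces; as a category this is the pointed homotopy category `HTop_*`. -/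
structure PtTop : Type (u + 1) where
  carrier : Type u
  [top : TopologicalSpace carrier]
  pt : carrier

attribute [instance] PtTop.top

/-- Maps of pointed spaces. -/
def PtMap (X Y : PtTop.{u}) := {f : C(X.carrier, Y.carrier) // f X.pt = Y.pt}

/-- Pointed homotopy of pointed maps: homotopy relative to the base point. -/
instance PtMap.setoid (X Y : PtTop.{u}) : Setoid (PtMap X Y) where
  r f g := f.1.HomotopicRel g.1 {X.pt}
  iseqv := ⟨fun f => .refl f.1, fun h => h.symm, fun h h' => h.trans h'⟩

/-- Composition of pointed maps. -/
def PtMap.comp {X Y Z : PtTop.{u}} (f : PtMap X Y) (g : PtMap Y Z) : PtMap X Z :=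
  ⟨g.1.comp f.1, by simp [f.2, g.2]⟩

theorem PtMap.comp_congr {X Y Z : PtTop.{u}} {f f' : PtMap X Y} {g g' : PtMap Y Z}
    (hf : f ≈ f') (hg : g ≈ g') : f.comp g ≈ f'.comp g' := by
  refine Setoid.trans (b := f.comp g') ?_ ?_
  · obtain ⟨G⟩ := hg
    refine ⟨⟨(G.toHomotopy.compContinuousMap f.1), ?_⟩⟩
    rintro t x rfl
    have := G.eq_fst t (x := f.1 X.pt) f.2
    simpa [PtMap.comp] using this
  · exact hf.comp_continuousMap g'.1

/-- The pointed homotopy category `HTop_*`. -/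
instance : Category PtTop.{u} where
  Hom X Y := Quotient (PtMap.setoid X Y)
  id X := ⟦⟨.id _, rfl⟩⟧
  comp f g := Quotient.map₂ PtMap.comp (fun _ _ hf _ _ hg => PtMap.comp_congr hf hg) f g
  id_comp f := by induction f using Quotient.inductionOn; rfl
  comp_id f := by induction f using Quotient.inductionOn; rfl
  assoc f g h := by
    induction f using Quotient.inductionOn
    induction g using Quotient.inductionOn
    induction h using Quotient.inductionOn
    rfl

/-- The pointed homotopy class of a pointed map. -/
def PtMap.toHom {X Y : PtTop.{u}} (f : PtMap X Y) : X ⟶ Y := Quotient.mk (PtMap.setoid X Y) f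

/-- A pointed homeomorphism is an isomorphism of `HTop_*`. -/
def isoOfHomeomorph {X Y : PtTop.{u}} (e : X.carrier ≃ₜ Y.carrier) (h : e X.pt = Y.pt) :
    X ≅ Y where
  hom := PtMap.toHom ⟨⟨e, e.continuous⟩, h⟩
  inv := PtMap.toHom ⟨⟨e.symm, e.symm.continuous⟩, by simp [← h]⟩
  hom_inv_id := congrArg (Quotient.mk _) (Subtype.ext (by ext x; exact e.symm_apply_apply x))
  inv_hom_id := congrArg (Quotient.mk _) (Subtype.ext (by ext x; exact e.apply_symm_apply x))

variable {V : Type u} (K : PreAbstractSimplicialComplex V)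

/-- The closed simplex spanned by the finite set `s`, in barycentric coordinates, with its
Euclidean topology (as a subspace of a power of `ℝ`). -/
def Simplex (s : Finset V) : Type u :=
  {t : V → ℝ // (∀ v, 0 ≤ t v) ∧ (∀ v ∉ s, t v = 0) ∧ ∑ v ∈ s, t v = 1}

instance (s : Finset V) : TopologicalSpace (Simplex s) :=
  inferInstanceAs (TopologicalSpace (Subtype _))

/-- The underlying set of the polyhedron `|K|`: the union of the closed simplices of `K`. -/
def Polyhedron : Type u :=
  {t : V → ℝ // ∃ s ∈ K.faces, (∀ v, 0 ≤ t v) ∧ (∀ v ∉ s, t v = 0) ∧ ∑ v ∈ s, t v = 1}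

/-- The inclusion of a closed simplex. -/
def Polyhedron.incl (s : K.faces) : Simplex s.1 → Polyhedron K := fun t => ⟨t.1, s.1, s.2, t.2⟩

/-- The weak topology: a set is closed if it meets each closed simplex in a closed set. -/
instance : TopologicalSpace (Polyhedron K) :=
  ⨆ s : K.faces, TopologicalSpace.coinduced (Polyhedron.incl K s) inferInstance

/-- The objects of `HPol_*`: the pointed spaces which have the pointed homotopy type of a pointed
polyhedron. -/
def HPol : ObjectProperty PtTop.{u} := fun X =>
  ∃ (V : Type u) (K : PreAbstractSimplicialComplex V) (x : Polyhedron K),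
    Nonempty (X ≅ ⟨Polyhedron K, x⟩)

end Pointed

/-! ### The pointed sphere is a pointed polyhedron -/

section Sphere

/-- The pointed sphere `(S^k, *)`: the Euclidean unit sphere of `ℝ^{k+1}` (lifted to the universe
at hand), with base point `(1, 0, …, 0)`. -/
noncomputable def sphere (k : ℕ) : PtTop.{u} where
  carrier := ULift.{u} (Metric.sphere (0 : EuclideanSpace ℝ (Fin (k + 1))) 1)
  pt := ⟨⟨EuclideanSpace.single 0 1, by simp⟩⟩

/-- The boundary complex of the cross-polytope, with vertices `±e_i`. -/
def crossPolytope (k : ℕ) : PreAbstractSimplicialComplex (ULift.{u} (Fin (k + 1)) × Bool) where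
  faces := {s | s.Nonempty ∧ ∀ i, ¬ ((i, true) ∈ s ∧ (i, false) ∈ s)}
  isRelLowerSet_faces := fun _ hs =>
    ⟨hs.1, fun _ hts ht => ⟨ht, fun i hi => hs.2 i ⟨hts hi.1, hts hi.2⟩⟩⟩

/-- The point of `ℝ^{k+1}` with given barycentric coordinates in the cross-polytope. -/
def crossVec (k : ℕ) (t : ULift.{u} (Fin (k + 1)) × Bool → ℝ) : EuclideanSpace ℝ (Fin (k + 1)) :=
  WithLp.toLp 2 fun i => t (⟨i⟩, true) - t (⟨i⟩, false)

theorem cross_spec {k : ℕ} (t : Polyhedron (crossPolytope.{u} k)) :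
    (∀ v, 0 ≤ t.1 v) ∧ (∀ i, t.1 (i, true) = 0 ∨ t.1 (i, false) = 0) ∧ ∑ v, t.1 v = 1 := by
  obtain ⟨t, s, hs, h0, hout, hsum⟩ := t
  refine ⟨h0, fun i => ?_, ?_⟩
  · by_cases h : (i, true) ∈ s
    · exact Or.inr (hout _ fun h' => hs.2 i ⟨h, h'⟩)
    · exact Or.inl (hout _ h)
  · refine Eq.trans ?_ hsum
    exact (Finset.sum_subset (Finset.subset_univ s) fun v _ hv => hout v hv).symm

theorem cross_sum {k : ℕ} (t : ULift.{u} (Fin (k + 1)) × Bool → ℝ) (h0 : ∀ v, 0 ≤ t v)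
    (hz : ∀ i, t (i, true) = 0 ∨ t (i, false) = 0) :
    ∑ v, t v = ∑ i, |crossVec k t i| := by
  rw [Fintype.sum_prod_type, ← Equiv.ulift.symm.sum_comp]
  refine Finset.sum_congr rfl fun i _ => ?_
  have h1 := h0 (⟨i⟩, true)
  have h2 := h0 (⟨i⟩, false)
  rcases hz ⟨i⟩ with h | h <;> simp [crossVec, h] <;> simp [abs_of_nonneg, h1, h2]

theorem crossVec_ne_zero {k : ℕ} (t : Polyhedron (crossPolytope.{u} k)) : crossVec k t.1 ≠ 0 := by
  intro h
  obtain ⟨h0, hz, hs⟩ := cross_spec t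
  rw [cross_sum _ h0 hz, h] at hs
  simp at hs

/-- Radial projection of the boundary of the cross-polytope to the sphere. -/
noncomputable def crossToSphere (k : ℕ) (t : Polyhedron (crossPolytope.{u} k)) :
    (sphere.{u} k).carrier :=
  ⟨⟨‖crossVec k t.1‖⁻¹ • crossVec k t.1, by
    have := norm_ne_zero_iff.2 (crossVec_ne_zero t)
    simp [norm_smul, this]⟩⟩

theorem continuous_crossToSphere (k : ℕ) : Continuous (crossToSphere.{u} k) := by
  refine continuous_iSup_dom.2 fun s => continuous_coinduced_dom.2 ?_
  refine continuous_uliftUp.comp (Continuous.subtype_mk ?_ _)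
  have hc : Continuous fun t : Simplex s.1 => crossVec k t.1 := by
    have h : ∀ v, Continuous fun t : Simplex s.1 => t.1 v := fun v =>
      (continuous_apply v).comp continuous_subtype_val
    exact (PiLp.continuous_toLp 2 _).comp (continuous_pi fun i => (h _).sub (h _))
  exact (hc.norm.inv₀ fun t =>
    norm_ne_zero_iff.2 (crossVec_ne_zero (Polyhedron.incl _ s t))).smul hc

theorem crossToSphere_injective (k : ℕ) : Function.Injective (crossToSphere.{u} k) := by
  intro t t' h
  have h : ‖crossVec k t.1‖⁻¹ • crossVec k t.1 = ‖crossVec k t'.1‖⁻¹ • crossVec k t'.1 :=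
    congrArg (fun y => (ULift.down y).1) h
  have n1 := norm_pos_iff.2 (crossVec_ne_zero t)
  have n2 := norm_pos_iff.2 (crossVec_ne_zero t')
  obtain ⟨h0, hz, hs⟩ := cross_spec t
  obtain ⟨h0', hz', hs'⟩ := cross_spec t'
  rw [cross_sum _ h0 hz] at hs
  rw [cross_sum _ h0' hz'] at hs'
  set a := crossVec k t.1 with ha
  set a' := crossVec k t'.1 with ha'
  have e : a = (‖a‖ * ‖a'‖⁻¹) • a' := by
    rw [mul_smul, ← h, smul_smul, mul_inv_cancel₀ n1.ne', one_smul]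
  have hc : 0 < ‖a‖ * ‖a'‖⁻¹ := by positivity
  have ec : ‖a‖ * ‖a'‖⁻¹ = 1 := by
    rw [e] at hs
    simp only [PiLp.smul_apply, smul_eq_mul, abs_mul, ← Finset.mul_sum, hs', mul_one] at hs
    rwa [← abs_mul, abs_of_pos hc] at hs
  rw [ec, one_smul] at e
  have key : ∀ i, t.1 (i, true) - t.1 (i, false) = t'.1 (i, true) - t'.1 (i, false) := fun i =>
    congrArg (fun y : EuclideanSpace ℝ (Fin (k + 1)) => y i.down) e
  refine Subtype.ext (funext ?_)
  rintro ⟨i, b⟩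
  have := key i
  have p1 := h0 (i, true)
  have p2 := h0 (i, false)
  have p3 := h0' (i, true)
  have p4 := h0' (i, false)
  cases b <;> rcases hz i with q | q <;> rcases hz' i with q' | q' <;> linarith

theorem crossToSphere_surjective (k : ℕ) : Function.Surjective (crossToSphere.{u} k) := by
  rintro ⟨⟨y, hy⟩⟩
  have hy1 : ‖y‖ = 1 := by simpa using hy
  have hy0 : y ≠ 0 := by rintro rfl; simp at hy1
  have hσ : 0 < ∑ i, |y i| := by
    refine Finset.sum_pos' (fun i _ => abs_nonneg _) ?_
    by_contra! H
    refine hy0 (PiLp.ext fun i => ?_)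
    exact abs_nonpos_iff.1 (H i (Finset.mem_univ i))
  set σ := ∑ i, |y i| with hσd
  let t : ULift.{u} (Fin (k + 1)) × Bool → ℝ := fun v =>
    if v.2 then σ⁻¹ * max (y v.1.down) 0 else σ⁻¹ * max (- y v.1.down) 0
  have h0 : ∀ v, 0 ≤ t v := by
    rintro ⟨i, b⟩
    cases b <;> simp only [t] <;> simp <;> positivity
  have hz : ∀ i, t (i, true) = 0 ∨ t (i, false) = 0 := by
    intro i
    rcases le_total (y i.down) 0 with h | h
    · left; simp [t, h]
    · right; simp [t, h]
  have hv : crossVec k t = σ⁻¹ • y := by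
    refine PiLp.ext fun i => ?_
    simp only [crossVec, t, PiLp.smul_apply, smul_eq_mul]
    rcases le_total (y i) 0 with h | h <;> simp [h]
  have hsum : ∑ v, t v = 1 := by
    rw [cross_sum t h0 hz, hv]
    simp only [PiLp.smul_apply, smul_eq_mul, abs_mul, ← Finset.mul_sum]
    rw [abs_of_pos (inv_pos.2 hσ), ← hσd, inv_mul_cancel₀ hσ.ne']
  have hmem : ∃ s ∈ (crossPolytope.{u} k).faces,
      (∀ v, 0 ≤ t v) ∧ (∀ v ∉ s, t v = 0) ∧ ∑ v ∈ s, t v = 1 := by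
    classical
    refine ⟨Finset.univ.filter fun v => t v ≠ 0, ⟨?_, fun i hi => ?_⟩, h0, fun v hv => ?_, ?_⟩
    · by_contra H
      rw [Finset.not_nonempty_iff_eq_empty, Finset.filter_eq_empty_iff] at H
      rw [Finset.sum_eq_zero fun v hv => not_not.1 (H hv)] at hsum
      exact zero_ne_one hsum
    · simp only [Finset.mem_filter, Finset.mem_univ, true_and] at hi
      exact (hz i).elim hi.1 hi.2
    · simpa using hv
    · rw [Finset.sum_filter_ne_zero, hsum]
  refine ⟨⟨t, hmem⟩, ?_⟩
  refine ULift.ext _ _ (Subtype.ext ?_)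
  change ‖crossVec k t‖⁻¹ • crossVec k t = y
  rw [hv, norm_smul, hy1, smul_smul]
  have : ‖σ⁻¹‖ = σ⁻¹ := by rw [Real.norm_of_nonneg (inv_pos.2 hσ).le]
  rw [this, mul_one, inv_mul_cancel₀ (inv_pos.2 hσ).ne', one_smul]

instance (k : ℕ) : T2Space (sphere.{u} k).carrier :=
  inferInstanceAs (T2Space (ULift (Metric.sphere (0 : EuclideanSpace ℝ (Fin (k + 1))) 1)))

/-- A closed simplex of a finite complex is compact. -/
instance {V : Type u} (s : Finset V) : CompactSpace (Simplex s) := by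
  have hcl : IsClosed {t : V → ℝ | (∀ v, 0 ≤ t v) ∧ (∀ v ∉ s, t v = 0) ∧ ∑ v ∈ s, t v = 1} := by
    simp only [Set.ofPred_and, Set.ofPred_forall]
    refine (isClosed_iInter fun v => ?_).inter
      ((isClosed_iInter fun v => isClosed_iInter fun _ => ?_).inter ?_)
    · exact isClosed_le continuous_const (continuous_apply v)
    · exact isClosed_eq (continuous_apply v) continuous_const
    · exact isClosed_eq (continuous_finsetSum _ fun v _ => continuous_apply v) continuous_const
  refine isCompact_iff_compactSpace.1 (IsCompact.of_isClosed_subset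
    (isCompact_univ_pi fun _ : V => isCompact_Icc (a := (0 : ℝ)) (b := 1)) hcl ?_)
  · rintro t ⟨h0, hz, hs⟩ v -
    refine ⟨h0 v, ?_⟩
    by_cases hv : v ∈ s
    · rw [← hs]; exact Finset.single_le_sum (fun w _ => h0 w) hv
    · rw [hz v hv]; exact zero_le_one

instance (k : ℕ) : CompactSpace (Polyhedron (crossPolytope.{u} k)) := by
  have : Finite (crossPolytope.{u} k).faces := inferInstance
  have hu : (⋃ s : (crossPolytope.{u} k).faces, Set.range (Polyhedron.incl _ s)) = Set.univ := by
    refine Set.eq_univ_of_forall fun t => ?_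
    obtain ⟨s, hs, h⟩ := t.2
    exact Set.mem_iUnion.2 ⟨⟨s, hs⟩, ⟨t.1, h⟩, rfl⟩
  refine ⟨hu ▸ isCompact_iUnion fun s => isCompact_range ?_⟩
  exact continuous_iSup_rng (i := s) continuous_coinduced_rng

/-- The pointed sphere belongs to `HPol_*`. -/
theorem sphere_mem (k : ℕ) : HPol (sphere.{u} k) := by
  let e : Polyhedron (crossPolytope.{u} k) ≃ₜ (sphere.{u} k).carrier :=
    Continuous.homeoOfEquivCompactToT2 (f := Equiv.ofBijective (crossToSphere k)
      ⟨crossToSphere_injective k, crossToSphere_surjective k⟩) (continuous_crossToSphere k)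
  exact ⟨_, crossPolytope k, e.symm (sphere k).pt, ⟨isoOfHomeomorph e.symm rfl⟩⟩

end Sphere

/-! ### Homotopy groups as pointed homotopy classes of maps of the sphere -/

section Homotopy

open scoped unitInterval

/-- The coordinates of a point of the cube, rescaled to `[-1, 1]`. -/
def cubeCoord {k : ℕ} (t : Fin k → I) : Fin k → ℝ := fun i => 2 * (t i : ℝ) - 1

theorem abs_cubeCoord_le {k : ℕ} (t : Fin k → I) (i : Fin k) : |cubeCoord t i| ≤ 1 := by
  have h0 := (t i).2.1
  have h1 := (t i).2.2
  rw [abs_le]; constructor <;> simp only [cubeCoord] <;> linarith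

theorem norm_cubeCoord_le {k : ℕ} (t : Fin k → I) : ‖cubeCoord t‖ ≤ 1 :=
  (pi_norm_le_iff_of_nonneg zero_le_one).2 fun i => abs_cubeCoord_le t i

theorem cubeCoord_injective {k : ℕ} : Function.Injective (cubeCoord (k := k)) := by
  intro t t' h
  funext i
  have := congrFun h i
  simp only [cubeCoord] at this
  exact Subtype.ext (by linarith)

theorem norm_cubeCoord_eq_one_iff {k : ℕ} [NeZero k] (t : Fin k → I) :
    ‖cubeCoord t‖ = 1 ↔ t ∈ Cube.boundary (Fin k) := by
  have key : ∀ i, |cubeCoord t i| = 1 ↔ t i = 0 ∨ t i = 1 := by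
    intro i
    rw [abs_eq zero_le_one, or_comm, Subtype.ext_iff, Subtype.ext_iff]
    simp only [cubeCoord, Set.Icc.coe_zero, Set.Icc.coe_one]
    constructor <;> rintro (h | h)
    · left; linarith
    · right; linarith
    · left; linarith
    · right; linarith
  constructor
  · intro h
    obtain ⟨i, -, hi⟩ := Finset.exists_max_image Finset.univ (fun i => |cubeCoord t i|)
      ⟨0, Finset.mem_univ _⟩
    refine ⟨i, (key i).1 (le_antisymm (abs_cubeCoord_le t i) ?_)⟩
    rw [← h]
    exact (pi_norm_le_iff_of_nonneg (abs_nonneg _)).2 fun j => hi j (Finset.mem_univ j)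
  · rintro ⟨i, hi⟩
    refine le_antisymm (norm_cubeCoord_le t) ?_
    rw [← (key i).2 hi]
    exact norm_le_pi_norm (cubeCoord t) i

/-- With `s ∈ [-1, 1]^k`, `b = 1 - max |s_i|` and `σ = ∑ s_i ^ 2`, the vector
`((σ - b²) / (σ + b²), 2 b s / (σ + b²))` of `ℝ^{k+1}`: the inverse stereographic projection of
`s / b`. -/
noncomputable def collapseVec {k : ℕ} (s : Fin k → ℝ) : EuclideanSpace ℝ (Fin (k + 1)) :=
  WithLp.toLp 2 (Fin.cons
    ((∑ i, s i ^ 2 - (1 - ‖s‖) ^ 2) / (∑ i, s i ^ 2 + (1 - ‖s‖) ^ 2))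
    fun i => 2 * (1 - ‖s‖) * s i / (∑ i, s i ^ 2 + (1 - ‖s‖) ^ 2))

theorem collapse_denom_pos {k : ℕ} (s : Fin k → ℝ) : 0 < ∑ i, s i ^ 2 + (1 - ‖s‖) ^ 2 := by
  by_cases h : s = 0
  · simp [h]
  · obtain ⟨i, hi⟩ := Function.ne_iff.1 h
    have : 0 < ∑ i, s i ^ 2 :=
      Finset.sum_pos' (fun _ _ => sq_nonneg _) ⟨i, Finset.mem_univ i, by
        have : s i ≠ 0 := hi
        positivity⟩
    positivity

theorem norm_collapseVec {k : ℕ} (s : Fin k → ℝ) : ‖collapseVec s‖ = 1 := by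
  have hD := collapse_denom_pos s
  have : ‖collapseVec s‖ ^ 2 = 1 := by
    rw [EuclideanSpace.norm_sq_eq, Fin.sum_univ_succ]
    simp only [collapseVec, Fin.cons_zero, Fin.cons_succ, Real.norm_eq_abs, sq_abs, div_pow,
      mul_pow]
    rw [← Finset.sum_div, ← Finset.mul_sum]
    field_simp
    ring
  exact (pow_eq_one_iff_of_nonneg (norm_nonneg _) two_ne_zero).1 this

theorem continuous_collapseVec (k : ℕ) : Continuous (collapseVec (k := k)) := by
  have hσ : Continuous fun s : Fin k → ℝ => ∑ i, s i ^ 2 := by fun_prop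
  refine (PiLp.continuous_toLp 2 _).comp (continuous_pi fun j => ?_)
  refine Fin.cases ?_ (fun i => ?_) j
  · simp only [Fin.cons_zero]
    exact Continuous.div (by fun_prop) (by fun_prop) fun s => (collapse_denom_pos s).ne'
  · simp only [Fin.cons_succ]
    exact Continuous.div (by fun_prop) (by fun_prop) fun s => (collapse_denom_pos s).ne'

/-- The map `I^k → S^k` which collapses the boundary of the cube to the base point and is
injective on its interior. -/
noncomputable def collapse (k : ℕ) : C(Fin k → I, (sphere.{u} k).carrier) where
  toFun t := ⟨⟨collapseVec (cubeCoord t), by simp [norm_collapseVec]⟩⟩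
  continuous_toFun := by
    refine continuous_uliftUp.comp (Continuous.subtype_mk ?_ _)
    refine (continuous_collapseVec k).comp ?_
    unfold cubeCoord
    fun_prop

theorem collapseVec_of_norm {k : ℕ} {s : Fin k → ℝ} (h : ‖s‖ = 1) :
    collapseVec s = EuclideanSpace.single 0 1 := by
  have hD := collapse_denom_pos s
  rw [h] at hD
  refine PiLp.ext fun j => ?_
  refine Fin.cases ?_ (fun i => ?_) j
  · simp only [collapseVec, Fin.cons_zero, h]
    simp only [sub_self, ne_eq, OfNat.ofNat_ne_zero, not_false_eq_true, zero_pow, sub_zero,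
      add_zero] at hD ⊢
    simp [hD.ne']
  · simp [collapseVec, h]

theorem collapse_boundary {k : ℕ} [NeZero k] (t : Fin k → I) (ht : t ∈ Cube.boundary (Fin k)) :
    collapse.{u} k t = (sphere k).pt :=
  ULift.ext _ _ (Subtype.ext (collapseVec_of_norm ((norm_cubeCoord_eq_one_iff t).2 ht)))

theorem collapseVec_eq {k : ℕ} {s s' : Fin k → ℝ} (h1 : ‖s‖ ≤ 1) (h1' : ‖s'‖ ≤ 1)
    (h : collapseVec s = collapseVec s') : s = s' ∨ (‖s‖ = 1 ∧ ‖s'‖ = 1) := by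
  have hD := collapse_denom_pos s
  have hD' := collapse_denom_pos s'
  have e0 := congrArg (fun y : EuclideanSpace ℝ (Fin (k + 1)) => y 0) h
  have ei := fun i => congrArg (fun y : EuclideanSpace ℝ (Fin (k + 1)) => y (Fin.succ i)) h
  simp only [collapseVec, Fin.cons_zero, Fin.cons_succ] at e0 ei
  obtain ⟨b, hb⟩ : ∃ b, b = 1 - ‖s‖ := ⟨_, rfl⟩
  obtain ⟨b', hb'⟩ : ∃ b', b' = 1 - ‖s'‖ := ⟨_, rfl⟩
  rw [← hb, ← hb'] at e0 ei
  rw [← hb] at hD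
  rw [← hb'] at hD'
  have f0 : b ^ 2 / (∑ i, s i ^ 2 + b ^ 2) = b' ^ 2 / (∑ i, s' i ^ 2 + b' ^ 2) := by
    have r : ∀ x y : ℝ, 0 < x + y → y / (x + y) = (1 - (x - y) / (x + y)) / 2 := by
      intro x y hxy; field_simp; ring
    rw [r _ _ hD, r _ _ hD', e0]
  by_cases hb0 : b = 0
  · have : b' = 0 := by
      rw [hb0] at f0
      simp only [ne_eq, OfNat.ofNat_ne_zero, not_false_eq_true, zero_pow, zero_div] at f0
      have := (div_eq_zero_iff.1 f0.symm).resolve_right hD'.ne'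
      exact pow_eq_zero_iff (two_ne_zero) |>.1 this
    right; constructor <;> linarith
  · have hbp : 0 < b := lt_of_le_of_ne (by linarith) (Ne.symm hb0)
    have hb0' : b' ≠ 0 := by
      rintro h0
      rw [h0] at f0
      simp only [ne_eq, OfNat.ofNat_ne_zero, not_false_eq_true, zero_pow, zero_div] at f0
      have := (div_eq_zero_iff.1 f0).resolve_right hD.ne'
      exact hb0 (pow_eq_zero_iff (two_ne_zero) |>.1 this)
    have hbp' : 0 < b' := lt_of_le_of_ne (by linarith) (Ne.symm hb0')
    have hs : ∀ i, s i / b = s' i / b' := by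
      intro i
      have a1 : s i / b = (2 * b * s i / (∑ i, s i ^ 2 + b ^ 2)) /
          (2 * (b ^ 2 / (∑ i, s i ^ 2 + b ^ 2))) := by field_simp
      have a2 : s' i / b' = (2 * b' * s' i / (∑ i, s' i ^ 2 + b' ^ 2)) /
          (2 * (b' ^ 2 / (∑ i, s' i ^ 2 + b' ^ 2))) := by field_simp
      rw [a1, a2, ei i, f0]
    have hv : b⁻¹ • s = b'⁻¹ • s' := by
      funext i
      have := hs i
      simp only [Pi.smul_apply, smul_eq_mul]
      rw [inv_mul_eq_div, inv_mul_eq_div, this]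
    have hn := congrArg norm hv
    rw [norm_smul, norm_smul, norm_inv, norm_inv, Real.norm_of_nonneg hbp.le,
      Real.norm_of_nonneg hbp'.le] at hn
    have n1 : ‖s‖ = 1 - b := by linarith
    have n2 : ‖s'‖ = 1 - b' := by linarith
    rw [n1, n2] at hn
    have hbb : b = b' := by
      field_simp at hn
      linarith
    left
    rw [← hbb] at hv
    exact smul_right_injective _ (inv_ne_zero hb0) hv

theorem collapse_eq {k : ℕ} [NeZero k] {t t' : Fin k → I}
    (h : collapse.{u} k t = collapse.{u} k t') :
    t = t' ∨ (t ∈ Cube.boundary (Fin k) ∧ t' ∈ Cube.boundary (Fin k)) := by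
  have h : collapseVec (cubeCoord t) = collapseVec (cubeCoord t') :=
    congrArg (fun y => (ULift.down y).1) h
  rw [← norm_cubeCoord_eq_one_iff, ← norm_cubeCoord_eq_one_iff]
  exact (collapseVec_eq (norm_cubeCoord_le t) (norm_cubeCoord_le t') h).imp_left
    fun e => cubeCoord_injective e

theorem collapse_surjective (k : ℕ) [NeZero k] : Function.Surjective (collapse.{u} k) := by
  rintro ⟨⟨y, hy⟩⟩
  have hy1 : ‖y‖ ^ 2 = 1 := by
    have : ‖y‖ = 1 := by simpa using hy
    rw [this, one_pow]
  rw [EuclideanSpace.norm_sq_eq, Fin.sum_univ_succ] at hy1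
  simp only [Real.norm_eq_abs, sq_abs] at hy1
  by_cases h0 : y 0 = 1
  · refine ⟨fun _ => 0, ?_⟩
    rw [collapse_boundary _ ⟨0, Or.inl rfl⟩]
    refine ULift.ext _ _ (Subtype.ext (PiLp.ext fun j => ?_))
    change EuclideanSpace.single (0 : Fin (k + 1)) (1 : ℝ) j = y j
    rw [h0] at hy1
    have hz : ∑ i : Fin k, y i.succ ^ 2 = 0 := by linarith
    rw [Finset.sum_eq_zero_iff_of_nonneg fun i _ => sq_nonneg _] at hz
    refine Fin.cases ?_ (fun i => ?_) j
    · simp [h0]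
    · have := hz i (Finset.mem_univ i)
      simp [pow_eq_zero_iff two_ne_zero |>.1 this]
  · have hlt : 0 < 1 - y 0 := by
      have : y 0 ^ 2 ≤ 1 := by
        have : 0 ≤ ∑ i : Fin k, y i.succ ^ 2 := Finset.sum_nonneg fun _ _ => sq_nonneg _
        linarith
      have := (abs_le.1 ((sq_le_one_iff_abs_le_one _).1 this)).2
      rcases this.lt_or_eq with h | h
      · linarith
      · exact absurd h h0
    let v : Fin k → ℝ := fun i => y i.succ / (1 - y 0)
    have hN : 0 < 1 + ‖v‖ := by positivity
    let s : Fin k → ℝ := (1 + ‖v‖)⁻¹ • v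
    have hsn : ‖s‖ = (1 + ‖v‖)⁻¹ * ‖v‖ := by
      rw [norm_smul, Real.norm_of_nonneg (inv_pos.2 hN).le]
    have hs1 : ‖s‖ ≤ 1 := by
      rw [hsn, inv_mul_eq_div, div_le_one hN]; linarith
    have hsb : 1 - ‖s‖ = (1 + ‖v‖)⁻¹ := by
      rw [hsn]; field_simp; ring
    have hvv : ∑ i, v i ^ 2 = (1 + y 0) / (1 - y 0) := by
      simp only [v, div_pow]
      rw [← Finset.sum_div, show ∑ i : Fin k, y i.succ ^ 2 = (1 + y 0) * (1 - y 0) by linarith]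
      field_simp
    have hss : ∑ i, s i ^ 2 = ((1 + ‖v‖)⁻¹) ^ 2 * ((1 + y 0) / (1 - y 0)) := by
      simp only [s, Pi.smul_apply, smul_eq_mul, mul_pow]
      rw [← Finset.mul_sum, hvv]
    have hD : ∑ i, s i ^ 2 + (1 - ‖s‖) ^ 2 = ((1 + ‖v‖)⁻¹) ^ 2 * (2 / (1 - y 0)) := by
      rw [hss, hsb]; field_simp; ring
    refine ⟨fun i => ⟨(s i + 1) / 2, ?_⟩, ?_⟩
    · have := abs_le.1 ((norm_le_pi_norm s i).trans hs1)
      constructor <;> linarith [this.1, this.2]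
    · refine ULift.ext _ _ (Subtype.ext ?_)
      have hc : cubeCoord (fun i => (⟨(s i + 1) / 2, by
          have := abs_le.1 ((norm_le_pi_norm s i).trans hs1)
          constructor <;> linarith [this.1, this.2]⟩ : I)) = s := by
        funext i; simp only [cubeCoord]; ring
      change collapseVec (cubeCoord _) = y
      rw [hc]
      refine PiLp.ext fun j => ?_
      refine Fin.cases ?_ (fun i => ?_) j
      · simp only [collapseVec, Fin.cons_zero]
        rw [hD, hss, hsb]
        field_simp
        ring
      · simp only [collapseVec, Fin.cons_succ]
        rw [hD, hsb]
        simp only [s, v, Pi.smul_apply, smul_eq_mul]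
        field_simp

/-- Composition with `I^k → S^k`, from pointed maps of the sphere to generalized loops. -/
noncomputable def toGenLoop {k : ℕ} [NeZero k] {X : PtTop.{u}} (f : PtMap (sphere k) X) :
    GenLoop (Fin k) X.carrier X.pt :=
  ⟨f.1.comp (collapse k), fun t ht => by
    rw [ContinuousMap.comp_apply, collapse_boundary t ht, f.2]⟩

theorem isQuotientMap_collapse (k : ℕ) [NeZero k] : IsQuotientMap (collapse.{u} k) :=
  IsQuotientMap.of_surjective_continuous (collapse_surjective k) (collapse k).continuous

theorem toGenLoop_surjective {k : ℕ} [NeZero k] {X : PtTop.{u}} :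
    Function.Surjective (toGenLoop (k := k) (X := X)) := by
  intro g
  have hg : Function.FactorsThrough g.1 (collapse.{u} k) := by
    intro t t' h
    rcases collapse_eq h with rfl | ⟨ht, ht'⟩
    · rfl
    · exact (g.2 t ht).trans (g.2 t' ht').symm
  have hl := (isQuotientMap_collapse k).lift_comp g.1 hg
  refine ⟨⟨(isQuotientMap_collapse k).lift g.1 hg, ?_⟩, Subtype.ext hl⟩
  have hb : (fun _ => 0 : Fin k → I) ∈ Cube.boundary (Fin k) := ⟨0, Or.inl rfl⟩
  rw [← collapse_boundary _ hb]
  exact (DFunLike.congr_fun hl _).trans (g.2 _ hb)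

theorem toGenLoop_homotopic_iff {k : ℕ} [NeZero k] {X : PtTop.{u}} (f g : PtMap (sphere k) X) :
    GenLoop.Homotopic (toGenLoop f) (toGenLoop g) ↔ f ≈ g := by
  constructor
  · rintro ⟨H⟩
    let c : C(I × (Fin k → I), I × (sphere.{u} k).carrier) :=
      (ContinuousMap.id I).prodMap (collapse k)
    have hc : IsQuotientMap c := IsQuotientMap.of_surjective_continuous
      (Function.surjective_id.prodMap (collapse_surjective k)) c.continuous
    have hH : Function.FactorsThrough H.toContinuousMap c := by
      rintro ⟨a, t⟩ ⟨a', t'⟩ h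
      obtain rfl : a = a' := congrArg Prod.fst h
      have h' : collapse.{u} k t = collapse.{u} k t' := congrArg Prod.snd h
      rcases collapse_eq h' with rfl | ⟨ht, ht'⟩
      · rfl
      · exact (H.eq_fst a ht).trans (((toGenLoop f).2 t ht).trans
          (((toGenLoop f).2 t' ht').symm.trans (H.eq_fst a ht').symm))
    have hl : ∀ a t, hc.lift H.toContinuousMap hH (a, collapse k t) = H (a, t) := fun a t =>
      DFunLike.congr_fun (hc.lift_comp H.toContinuousMap hH) (a, t)
    refine ⟨⟨⟨hc.lift H.toContinuousMap hH, ?_, ?_⟩, ?_⟩⟩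
    · intro y
      obtain ⟨t, rfl⟩ := collapse_surjective k y
      exact (hl 0 t).trans (H.apply_zero t)
    · intro y
      obtain ⟨t, rfl⟩ := collapse_surjective k y
      exact (hl 1 t).trans (H.apply_one t)
    · rintro a y rfl
      have hb : (fun _ => 0 : Fin k → I) ∈ Cube.boundary (Fin k) := ⟨0, Or.inl rfl⟩
      have := (hl a _).trans (H.eq_fst a hb)
      change hc.lift H.toContinuousMap hH (a, (sphere k).pt) = f.1 (sphere k).pt
      rwa [collapse_boundary _ hb, show (toGenLoop f).1 _ = f.1 _ from rfl,
        collapse_boundary _ hb] at this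
  · rintro ⟨H⟩
    refine ⟨⟨⟨⟨fun z => H (z.1, collapse k z.2), by fun_prop⟩, ?_, ?_⟩, ?_⟩⟩
    · intro t; exact H.apply_zero _
    · intro t; exact H.apply_one _
    · intro a t ht
      exact H.eq_fst a (collapse_boundary t ht)

/-- The bijection `[(S^k, *), (X, x)] ≃ π_k(X, x)` induced by `I^k → S^k`. -/
noncomputable def piEquiv (k : ℕ) [NeZero k] (X : PtTop.{u}) :
    (sphere k ⟶ X) ≃ HomotopyGroup (Fin k) X.carrier X.pt :=
  Equiv.ofBijective
    (Quotient.map (sa := PtMap.setoid _ _) toGenLoop fun f g h =>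
      (toGenLoop_homotopic_iff f g).2 h) (by
    constructor
    · intro f g h
      induction f using Quotient.inductionOn with | _ f => ?_
      induction g using Quotient.inductionOn with | _ g => ?_
      exact Quotient.sound ((toGenLoop_homotopic_iff f g).1 (Quotient.exact h))
    · intro g
      induction g using Quotient.inductionOn with | _ g => ?_
      obtain ⟨f, rfl⟩ := toGenLoop_surjective g
      exact ⟨PtMap.toHom f, rfl⟩)

/-- The homotopy group structure on the set of pointed homotopy classes of maps
`(S^k, *) → (X, x)`, `k ≥ 1`. -/
noncomputable instance homotopyGroup (k : ℕ) [NeZero k] (X : PtTop.{u}) : Group (sphere k ⟶ X) :=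
  (piEquiv k X).group

theorem mul_comp {k : ℕ} [NeZero k] {X Y : PtTop.{u}} (a b : sphere k ⟶ X) (g : X ⟶ Y) :
    (a * b) ≫ g = (a ≫ g) * (b ≫ g) := by
  obtain ⟨a, rfl⟩ : ∃ f : PtMap (sphere k) X, PtMap.toHom f = a := Quotient.exists_rep a
  obtain ⟨b, rfl⟩ : ∃ f : PtMap (sphere k) X, PtMap.toHom f = b := Quotient.exists_rep b
  obtain ⟨g, rfl⟩ : ∃ f : PtMap X Y, PtMap.toHom f = g := Quotient.exists_rep g
  obtain ⟨c, hc⟩ := toGenLoop_surjective (GenLoop.transAt 0 (toGenLoop b) (toGenLoop a))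
  have h₁ : PtMap.toHom a * PtMap.toHom b = PtMap.toHom c := by
    apply (piEquiv k X).injective
    refine ((piEquiv k X).apply_symm_apply _).trans ?_
    refine (HomotopyGroup.mul_spec (i := (0 : Fin k))).trans ?_
    exact congrArg (Quotient.mk _) hc.symm
  have h₂ : PtMap.toHom (a.comp g) * PtMap.toHom (b.comp g) = PtMap.toHom (c.comp g) := by
    apply (piEquiv k Y).injective
    refine ((piEquiv k Y).apply_symm_apply _).trans ?_
    refine (HomotopyGroup.mul_spec (i := (0 : Fin k))).trans ?_
    refine congrArg (Quotient.mk _) (GenLoop.ext _ _ fun t => ?_)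
    have := congrArg g.1 (DFunLike.congr_fun (congrArg Subtype.val hc) t)
    refine Eq.trans ?_ this.symm
    change (if _ then _ else _) = g.1 (if _ then _ else _)
    split_ifs <;> rfl
  rw [h₁]
  exact h₂.symm

end Homotopy

/-! ### The topological coarse shape homotopy groups -/

section CoarseGroup

/-- Composition with a morphism `g : X ⟶ Y` of `HTop_*`, as a homomorphism `π_k(X) → π_k(Y)`. -/
noncomputable def postHom {k : ℕ} [NeZero k] {X Y : PtTop.{u}} (g : X ⟶ Y) :
    (sphere k ⟶ X) →* (sphere k ⟶ Y) :=
  MonoidHom.mk' (fun a => a ≫ g) fun a b => mul_comp a b g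

variable {k : ℕ} {S : InvSys.{u} PtTop.{u}}

/-- The components `f^n_λ : (S^k, *) → (X_λ, x_λ)` of an `S*`-morphism from the rudimentary system
of the sphere. -/
def SStar.comp₀ (f : SStar (rudimentary.{u} (sphere.{u} k)) S) (n : ℕ) (l : S.Idx) :
    sphere.{u} k ⟶ S.obj l := f.hom n l

theorem SStar.comp₀_compat (f : SStar (rudimentary.{u} (sphere.{u} k)) S) {l l' : S.Idx}
    (h : l ≤ l') : ∃ n, ∀ n' ≥ n, f.comp₀ n' l' ≫ S.bond h = f.comp₀ n' l := by
  obtain ⟨_, _, _, n, H⟩ := f.compat h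
  exact ⟨n, fun n' hn => ((Category.id_comp _).symm.trans (H n' hn)).trans (Category.id_comp _)⟩

theorem SStar.equiv_iff (f g : SStar (rudimentary.{u} (sphere.{u} k)) S) :
    f ≈ g ↔ ∀ l, ∃ n, ∀ n' ≥ n, f.comp₀ n' l = g.comp₀ n' l := by
  constructor
  · intro H l
    obtain ⟨_, _, _, n, H⟩ := H l
    exact ⟨n, fun n' hn => ((Category.id_comp _).symm.trans (H n' hn)).trans (Category.id_comp _)⟩
  · intro H l
    obtain ⟨n, H⟩ := H l
    exact ⟨PUnit.unit, le_rfl, le_rfl, n, fun n' hn => congrArg (𝟙 (sphere.{u} k) ≫ ·) (H n' hn)⟩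

/-- The `S*`-morphism from the rudimentary system of the sphere with given components. -/
def SStar.ofComp (a : ∀ (_ : ℕ) (l : S.Idx), sphere.{u} k ⟶ S.obj l)
    (ha : ∀ {l l' : S.Idx} (h : l ≤ l'), ∃ n, ∀ n' ≥ n, a n' l' ≫ S.bond h = a n' l) :
    SStar (rudimentary.{u} (sphere.{u} k)) S where
  idx _ := PUnit.unit
  hom := a
  compat h := by
    obtain ⟨n, H⟩ := ha h
    exact ⟨PUnit.unit, le_rfl, le_rfl, n, fun n' hn => congrArg (𝟙 (sphere.{u} k) ≫ ·) (H n' hn)⟩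

/-- The topological coarse shape homotopy group `Sh*((S^k, *), (X, x))`, for the pair
`(HTop_*, HPol_*)`, with the topology of the set of coarse shape morphisms. -/
abbrev CoarsePi (k : ℕ) (X : PtTop.{u}) := Sh.{u} HPol (sphere k) X

/-- The representation of coarse shape morphisms `(S^k, *) → (X, x)` by morphisms `(S^k, *) → 𝐗` of
`pro*-HPol_*`, for an `HPol_*`-expansion of `(X, x)`. -/
noncomputable def CoarsePi.repr (k : ℕ) {X : PtTop.{u}} (p : Expansion.{u} HPol X) :
    CoarsePi k X ≃ (rudimentary.{u} (sphere.{u} k) ⟶ p.sys) :=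
  Sh.repr (Expansion.rud (sphere_mem k)) p

theorem CoarsePi.repr_eq_comp {X : PtTop.{u}} (p p' : Expansion.{u} HPol X) (F : CoarsePi k X) :
    CoarsePi.repr k p' F = CoarsePi.repr k p F ≫ p.lift p' (𝟙 X) :=
  Sh.repr_lift _ _ _ _

theorem CoarsePi.repr_comp_shProj {X : PtTop.{u}} (p : Expansion.{u} HPol X) (l : p.sys.Idx)
    (F : CoarsePi k X) :
    CoarsePi.repr k (Expansion.rud (p.mem l)) (F.comp (p.shProj l)) =
      CoarsePi.repr k p F ≫ p.lift (Expansion.rud (p.mem l)) (p.proj l) :=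
  Sh.repr_comp _ _ _ _ _

instance Expansion.nonempty_term {X : PtTop.{u}} (p : Expansion.{u} HPol X) (l : p.sys.Idx) :
    Nonempty (Expansion.{u} HPol (p.sys.obj l)) := ⟨Expansion.rud (p.mem l)⟩

variable [NeZero k]

/-- The group structure on the morphisms `(S^k, *) → 𝐗` of `pro*-HTop_*`, given by
`[(f^n_λ)] + [(g^n_λ)] = [(f^n_λ + g^n_λ)]` (written multiplicatively). -/
noncomputable instance proStarGroup : Group (rudimentary.{u} (sphere.{u} k) ⟶ S) :=
  letI : Mul (rudimentary.{u} (sphere.{u} k) ⟶ S) :=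
    ⟨Quotient.map₂ (fun f g => SStar.ofComp (fun n l => f.comp₀ n l * g.comp₀ n l) fun h => by
        obtain ⟨n, H⟩ := f.comp₀_compat h
        obtain ⟨m, H'⟩ := g.comp₀_compat h
        exact ⟨max n m, fun N hN => by
          rw [mul_comp, H N (le_of_max_le_left hN), H' N (le_of_max_le_right hN)]⟩)
      (fun f f' hf g g' hg => by
        rw [SStar.equiv_iff] at *
        intro l
        obtain ⟨n, H⟩ := hf l
        obtain ⟨m, H'⟩ := hg l
        exact ⟨max n m, fun N hN => congrArg₂ (· * ·) (H N (le_of_max_le_left hN))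
          (H' N (le_of_max_le_right hN))⟩)⟩
  letI : One (rudimentary.{u} (sphere.{u} k) ⟶ S) :=
    ⟨Quotient.mk _ (SStar.ofComp (fun _ _ => 1) fun h =>
      ⟨0, fun _ _ => map_one (postHom (k := k) (S.bond h))⟩)⟩
  letI : Inv (rudimentary.{u} (sphere.{u} k) ⟶ S) :=
    ⟨Quotient.map (fun f => SStar.ofComp (fun n l => (f.comp₀ n l)⁻¹) fun h => by
        obtain ⟨n, H⟩ := f.comp₀_compat h
        exact ⟨n, fun N hN => (map_inv (postHom (k := k) (S.bond h)) _).trans (congrArg _ (H N hN))⟩)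
      (fun f f' hf => by
        rw [SStar.equiv_iff] at *
        intro l
        obtain ⟨n, H⟩ := hf l
        exact ⟨n, fun N hN => congrArg (·⁻¹) (H N hN)⟩)⟩
  Group.ofLeftAxioms
    (fun a b c => by
      induction a using Quotient.inductionOn with | _ a => ?_
      induction b using Quotient.inductionOn with | _ b => ?_
      induction c using Quotient.inductionOn with | _ c => ?_
      exact Quotient.sound ((SStar.equiv_iff _ _).2 fun l => ⟨0, fun n _ => mul_assoc _ _ _⟩))
    (fun a => by
      induction a using Quotient.inductionOn with | _ a => ?_
      exact Quotient.sound ((SStar.equiv_iff _ _).2 fun l => ⟨0, fun n _ => one_mul _⟩))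
    (fun a => by
      induction a using Quotient.inductionOn with | _ a => ?_
      exact Quotient.sound ((SStar.equiv_iff _ _).2 fun l => ⟨0, fun n _ => inv_mul_cancel _⟩))

theorem proStar_mul_comp {T : InvSys.{u} PtTop.{u}} (a b : rudimentary.{u} (sphere.{u} k) ⟶ S)
    (g : S ⟶ T) : (a * b) ≫ g = (a ≫ g) * (b ≫ g) := by
  induction a using Quotient.inductionOn with | _ a => ?_
  induction b using Quotient.inductionOn with | _ b => ?_
  induction g using Quotient.inductionOn with | _ g => ?_
  exact Quotient.sound ((SStar.equiv_iff _ _).2 fun l => ⟨0, fun n _ => mul_comp _ _ _⟩)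

/-- The group structure of the coarse shape homotopy group: the sum of `<𝐟*>` and `<𝐠*>` is
`<𝐟* + 𝐠*>`. It is the same for all `HPol_*`-expansions of `(X, x)`, see `CoarsePi.repr_mul`. -/
noncomputable instance CoarsePi.group (X : PtTop.{u}) [h : Nonempty (Expansion.{u} HPol X)] :
    Group (CoarsePi k X) :=
  (CoarsePi.repr k h.some).group

theorem CoarsePi.repr_mul {X : PtTop.{u}} [h : Nonempty (Expansion.{u} HPol X)]
    (p : Expansion.{u} HPol X) (F G : CoarsePi k X) :
    CoarsePi.repr k p (F * G) = CoarsePi.repr k p F * CoarsePi.repr k p G := by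
  have e : CoarsePi.repr k h.some (F * G) = CoarsePi.repr k h.some F * CoarsePi.repr k h.some G :=
    (CoarsePi.repr k h.some).apply_symm_apply _
  rw [CoarsePi.repr_eq_comp h.some p, CoarsePi.repr_eq_comp h.some p,
    CoarsePi.repr_eq_comp h.some p, e, proStar_mul_comp]

/-- The homomorphism of coarse shape homotopy groups induced by `p_λ`, `F ↦ p_λ ∘ F`. -/
noncomputable def Expansion.projHom {X : PtTop.{u}} (p : Expansion.{u} HPol X) (k : ℕ) [NeZero k]
    (l : p.sys.Idx) :
    haveI : Nonempty (Expansion.{u} HPol X) := ⟨p⟩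
    CoarsePi k X →* CoarsePi k (p.sys.obj l) :=
  haveI : Nonempty (Expansion.{u} HPol X) := ⟨p⟩
  MonoidHom.mk' (fun F => F.comp (p.shProj l)) fun F G => by
    apply (CoarsePi.repr k (Expansion.rud (p.mem l))).injective
    rw [CoarsePi.repr_mul, CoarsePi.repr_comp_shProj, CoarsePi.repr_comp_shProj,
      CoarsePi.repr_comp_shProj, CoarsePi.repr_mul, proStar_mul_comp]

end CoarseGroup

end CoarseShape

/-! ### Discreteness and the fibres of the projections -/

namespace CoarseShape

open CategoryTheory

/-! The basic set `V_λ^F` is the fibre through `F` of the map `F ↦ p_λ ∘ F`, so discreteness of a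
coarse shape set is a question about how small these fibres can be made.

If `X` is itself an object of the subcategory, it has the one-term expansion whose projection is the
identity. Composition with that projection changes nothing, so its fibres are single points. This
argument (`Sh.discreteTopology_of_mem`) works for any pair of a category and a full subcategory, and
involves neither spheres nor groups.

Conversely, let the coarse shape homotopy group be discrete. Its neutral element is then isolated,
so for some `λ` the fibre of `(p_λ)_*` through it is trivial. That fibre is the kernel of a
homomorphism, hence `(p_λ)_*` is injective (`Expansion.exists_projHom_injective`). The term `X_λ`
lies in `HPol`, so the target group is discrete by the first part, and an injective map between
discrete spaces is an embedding.

Two earlier facts carry the argument. `Sh.isTopologicalBasis` says that the basic sets of any one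
expansion already form a basis, although the topology is generated from all expansions; its proof
uses the factorization property of expansions and the directedness of the index set.
`Expansion.projHom` is a homomorphism because the addition is made levelwise in the groups of the
terms and is respected by composition in pro* (`proStar_mul_comp`), independently of the expansion
chosen to define it (`CoarsePi.repr_mul`). -/

/-- If `X` belongs to `P`, then `Sh*(Y, X)` is discrete: for the rudimentary expansion of `X` the
set `V^F` is the singleton `{F}`. -/
theorem Sh.discreteTopology_of_mem {C : Type u} [Category.{v} C] {P : ObjectProperty C} (Y : C)
    {X : C} (hX : P X) : DiscreteTopology (Sh.{w} P Y X) := by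
  refine discreteTopology_iff_isOpen_singleton.2 fun F => ?_
  -- The only projection of the rudimentary expansion is the image of `𝟙 X` under the coarse shape
  -- functor, and this is a right unit for composition.
  have comp_proj : ∀ G : Sh.{w} P Y X,
      G.comp ((Expansion.rud hX).shProj PUnit.unit) = G := fun G =>
    -- In `shProj` the target carries the rudimentary expansion of the term, which is `X` only after
    -- unfolding; independence of the expansions brings it to the form with one expansion on both
    -- sides that `Sh.comp_ofHom_id` requires.
    (congrArg G.comp (Sh.ofHom_eq _ _ _ _ _)).trans (G.comp_ofHom_id (Expansion.rud hX))
  -- Every expansion of `X` contributes generators, so the rudimentary one may be used directly and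
  -- no comparison of expansions is needed here.
  refine TopologicalSpace.isOpen_generateFrom_of_mem
    ⟨Expansion.rud hX, PUnit.unit, F, Set.ext fun G => ?_⟩
  change G = F ↔ F.comp _ = G.comp _
  rw [comp_proj F, comp_proj G]
  exact eq_comm

/-- If the coarse shape homotopy group is discrete, then some `(p_λ)_*` is injective. -/
theorem Expansion.exists_projHom_injective {X : PtTop.{u}} (p : Expansion.{u} HPol X) (k : ℕ)
    [NeZero k] [DiscreteTopology (CoarsePi k X)] :
    ∃ l : p.sys.Idx, Function.Injective (p.projHom k l) := by
  -- The group structure presupposes some expansion. As `Nonempty` is a proposition, the group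
  -- obtained here is the one in the type of `p.projHom`.
  have : Nonempty (Expansion.{u} HPol X) := ⟨p⟩
  -- The basis belonging to `p` itself is essential, since `l` has to index a term of the given
  -- expansion. The centre `F` of the basic set is arbitrary; `h1` only says that `F` and `1` have
  -- the same image under `p_l`.
  obtain ⟨_, ⟨l, F, rfl⟩, h1, hsub⟩ :=
    (Sh.isTopologicalBasis (sphere.{u} k) p).exists_subset_of_mem_open
      (Set.mem_singleton (1 : CoarsePi k X)) (isOpen_discrete _)
  -- Here the group structure enters: control of the one fibre through `1` suffices for injectivity
  -- everywhere.
  refine ⟨l, (injective_iff_map_eq_one (p.projHom k l)).2 fun G hG => ?_⟩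
  have e : (1 : CoarsePi k X).comp (p.shProj l) = G.comp (p.shProj l) :=
    (map_one (p.projHom k l)).trans hG.symm
  -- `F`, `1` and `G` all have the same image under `p_l`, so `G` lies in the basic set around `F`,
  -- which is contained in `{1}`.
  exact hsub (Eq.trans h1 e)

end CoarseShape

/-- The condition `k ≥ 1` is the instance `[NeZero k]`. In the second part the expansion `p` also
supplies the group structure on the source, and the rudimentary expansion of the term supplies the
one on the target. Since `projHom` is bundled as a homomorphism, injectivity makes the source a
subgroup of the target algebraically, and the embedding property makes it one topologically. -/
theorem theorem5p2 (X : CoarseShape.PtTop.{u}) (k : ℕ) [NeZero k] :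
    (CoarseShape.HPol X → DiscreteTopology (CoarseShape.CoarsePi k X)) ∧
    (∀ p : CoarseShape.Expansion.{u} CoarseShape.HPol X,
      DiscreteTopology (CoarseShape.CoarsePi k X) →
        ∃ l : p.sys.Idx, Function.Injective (p.projHom k l) ∧
          Topology.IsEmbedding (p.projHom k l)) := by
  refine ⟨CoarseShape.Sh.discreteTopology_of_mem _, fun p _ => ?_⟩
  obtain ⟨l, hl⟩ := p.exists_projHom_injective k
  -- The first part is applied to the term `X_l`, an object of `HPol` by the definition of an
  -- expansion, whether or not `X` is one.
  have : DiscreteTopology (CoarseShape.CoarsePi k (p.sys.obj l)) :=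
    CoarseShape.Sh.discreteTopology_of_mem _ (p.mem l)
  -- Continuity comes from the discrete source, openness of the map from the discrete target.
  exact ⟨l, hl, (Topology.IsOpenEmbedding.of_continuous_injective_isOpenMap
    continuous_of_discreteTopology hl fun _ _ => isOpen_discrete _).isEmbedding⟩
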